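/- Let $G=(V,E)$ be a finite connected simple graph with line susceptances $b_e>0$ ($e\in E$), and let $p\in\mathbb R^V$ be a balanced injection vector, i.e. $\sum_{i\in V}p_i=0$. For injections $q$ on a network with line set $E'\subseteq E$, whose islands are its connected components, $q$ is balanced if $\sum_{i\in\mathcal J}q_i=0$ for every island $\mathcal J$, and a DC flow is an antisymmetric line flow $f$ ($f_{ji}=-f_{ij}$) such that $f_{ij}=b_{ij}(\theta_i-\theta_j)$ on every line for some phase angles $\theta\in\mathbb R^V$, and $q_i=\sum_{j:\{i,j\}\in E'}f_{ij}$ for every $i\in V$. Let $\mathcal E\subseteq E$ be a cut set of outaged lines, i.e. $(V,E\setminus\mathcal E)$ is disconnected, and let $\mathcal I$ be one of its islands. Let $\mathcal E_{\rm int}$ be the set of lines of $\mathcal E$ with both endpoints in $\mathcal I$, and $\mathcal E_{\rm tie}$ the set of those with exactly one endpoint in $\mathcal I$; for $\hat\ell\in\mathcal E_{\rm tie}$ let $j(\hat\ell)$ be its endpoint in $\mathcal I$. Suppose that $\mathcal I$ is under proportional control: there are weights $\alpha_i\ge 0$ $(i\in\mathcal I)$ with $\sum_{i\in\mathcal I}\alpha_i=1$,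 and the injections after the outage are $\tilde p_i=p_i-\alpha_i\sum_{m\in\mathcal I}p_m$ for $i\in\mathcal I$. On the other islands, $\tilde p$ is arbitrary except that it is balanced on each of them. Let $G_{\mathcal I}=(\mathcal I,E_{\mathcal I})$ be the subgraph of $G$ induced on $\mathcal I$ before the outage. Two lines are in the same block of $G_{\mathcal I}$ if they are equal or some simple cycle of $G_{\mathcal I}$ contains both. Let $\ell\in E_{\mathcal I}\setminus\mathcal E_{\rm int}$ be a surviving line of $\mathcal I$. Suppose that $\ell$ is not in the same block of $G_{\mathcal I}$ as any $\hat\ell\in\mathcal E_{\rm int}$, and that for every $\hat\ell\in\mathcal E_{\rm tie}$ and every $k\in\mathcal I$ with $\alpha_k>0$, no simple path of $G_{\mathcal I}$ from $j(\hat\ell)$ to $k$ contains $\ell$. Then the flow on $\ell$ is unchanged: the network $(V,E)$ with injections $p$ has a unique DC flow $f$, the network $(V,E\setminus\mathcal E)$ with injections $\tilde p$ has a unique DC flow $\tilde f$, and $\tilde f_\ell=f_\ell$. -/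

import Mathlib

/-!
Conventions: a power network is a finite simple graph `G` on the set of buses `V` together with
a susceptance `b e > 0` for each line `e ∈ G.edgeSet`.  Line flows are recorded without choosing
an orientation: `f i j` is the flow from `i` to `j` on the line `s(i, j)`, so `f j i = - f i j`,
and `f` is zero at pairs that are not lines.
-/

/-- `f` is a line flow of the DC power flow model on the network `(G, b)` with injections `p`:
Kirchhoff's law `f_{ij} = b_{ij} (θ_i - θ_j)` on every line, for some phase angles `θ`, and flow
conservation (the injection at a bus is the net flow out of the bus). -/
def IsDCFlow {V : Type*} [Fintype V] (G : SimpleGraph V) (b : Sym2 V → ℝ) (p : V → ℝ)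
    (f : V → V → ℝ) : Prop :=
  (∃ θ : V → ℝ, ∀ i j, G.Adj i j → f i j = b s(i, j) * (θ i - θ j)) ∧
  (∀ i j, ¬ G.Adj i j → f i j = 0) ∧
  (∀ i, p i = ∑ j, f i j)

open Classical in
/-- The total `∑_{i ∈ S} p_i` over a set `S` of buses. -/
noncomputable def sumOver {V : Type*} [Fintype V] (S : Set V) (p : V → ℝ) : ℝ :=
  ∑ i with i ∈ S, p i

/-- Injections are balanced if they sum to zero over every island (connected component). -/
def BalancedInjections {V : Type*} [Fintype V] (G : SimpleGraph V) (p : V → ℝ) : Prop :=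
  ∀ I : G.ConnectedComponent, sumOver I.supp p = 0

/-- A cut set: a set of lines whose deletion disconnects the (connected) graph `G`. -/
def IsCutSet {V : Type*} (G : SimpleGraph V) (F : Set (Sym2 V)) : Prop :=
  F ⊆ G.edgeSet ∧ ¬ (G.deleteEdges F).Connected

/-- The weights `α_i`, `i ∈ S`, of a proportional control on the island `S`. -/
def IsProportionalControl {V : Type*} [Fintype V] (S : Set V) (α : V → ℝ) : Prop :=
  (∀ i ∈ S, 0 ≤ α i) ∧ sumOver S α = 1

/-- `p'` arises from `p` on the island `S` by the proportional control with weights `α`: every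
bus `i ∈ S` adjusts its injection by `-α_i b_S`, where `b_S = ∑_{i ∈ S} p_i` is the imbalance. -/
def AdjustedBy {V : Type*} [Fintype V] (S : Set V) (α p p' : V → ℝ) : Prop :=
  ∀ i ∈ S, p' i = p i - α i * sumOver S p

/-- Two lines are in the same block of `G`: they are equal, or some simple cycle contains both. -/
def SameBlock {V : Type*} (G : SimpleGraph V) (e e' : Sym2 V) : Prop :=
  e = e' ∨ ∃ (w : V) (c : G.Walk w w), c.IsCycle ∧ e ∈ c.edges ∧ e' ∈ c.edges

/-! On the island with its pre-outage lines, let φ be the difference of the phase angles after and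
before the outage. Its Laplacian is a superposition of transfers: each lost tie-line flow is moved
between its endpoint and the controlled buses in proportion to `α`, and each outaged internal line
acts as a fictitious transfer between its own ends. Pair φ with the potential y of a unit transfer
from u to v: by self-adjointness, φ u - φ v is the work of these transfers against y.

Each transfer does no work, because y agrees at s and t unless a simple path from s to t uses the
line uv (`potential_eq_of_forall_isPath`). By reciprocity, y s - y t is the drop across uv of the
potential of a unit s-t transfer; were it nonzero, following that current both ways from uv would
give such a path. The hypotheses exclude these paths, so φ u = φ v and the flow on uv is unchanged.
-/

theorem eq_of_reachable_of_forall_adj {V β : Type*} {H : SimpleGraph V} {x : V → β}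
    (hx : ∀ i j, H.Adj i j → x i = x j) {s t : V} (h : H.Reachable s t) : x s = x t := by
  obtain ⟨P⟩ := h
  induction P with
  | nil => rfl
  | cons h _ ih => exact (hx _ _ h).trans ih

/-- The weighted graph Laplacian with weights `c`. -/
def weightedLap {V : Type*} [Fintype V] (c : V → V → ℝ) (x : V → ℝ) (i : V) : ℝ :=
  ∑ j, c i j * (x i - x j)

/-! ### Weighted Laplacians: energy, solvability, reciprocity -/

section Laplacian

variable {V : Type*} [Fintype V] {c : V → V → ℝ}

theorem weightedLap_neg (x : V → ℝ) (i : V) :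
    weightedLap c (fun k => -x k) i = -weightedLap c x i := by
  simp only [weightedLap, ← Finset.sum_neg_distrib]
  exact Finset.sum_congr rfl fun j _ => by ring

/-- Green's identity. -/
theorem two_mul_sum_mul_weightedLap (hc : ∀ i j, c i j = c j i) (x y : V → ℝ) :
    2 * ∑ i, x i * weightedLap c y i = ∑ i, ∑ j, c i j * ((x i - x j) * (y i - y j)) := by
  have h1 : ∑ i, x i * weightedLap c y i = ∑ i, ∑ j, x i * (c i j * (y i - y j)) := by
    simp only [weightedLap, Finset.mul_sum]
  have h2 : ∑ i, x i * weightedLap c y i = ∑ i, ∑ j, x j * (c i j * (y j - y i)) := by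
    rw [h1, Finset.sum_comm]
    exact Finset.sum_congr rfl fun i _ => Finset.sum_congr rfl fun j _ => by rw [hc]
  rw [two_mul]
  nth_rewrite 1 [h1]
  rw [h2]
  simp only [← Finset.sum_add_distrib]
  exact Finset.sum_congr rfl fun i _ => Finset.sum_congr rfl fun j _ => by ring

theorem sum_mul_weightedLap_comm (hc : ∀ i j, c i j = c j i) (x y : V → ℝ) :
    ∑ i, x i * weightedLap c y i = ∑ i, y i * weightedLap c x i := by
  have h : 2 * ∑ i, x i * weightedLap c y i = 2 * ∑ i, y i * weightedLap c x i := by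
    rw [two_mul_sum_mul_weightedLap hc, two_mul_sum_mul_weightedLap hc]
    exact Finset.sum_congr rfl fun i _ => Finset.sum_congr rfl fun j _ => by ring
  linarith

/-- The Dirichlet energy of such an `x` vanishes, and it is a sum of nonnegative terms. -/
theorem eq_of_weightedLap_eq_zero (hc : ∀ i j, c i j = c j i) (h0 : ∀ i j, 0 ≤ c i j)
    {x : V → ℝ} (hx : ∀ i, weightedLap c x i = 0) {i j : V} (hij : 0 < c i j) : x i = x j := by
  have h := two_mul_sum_mul_weightedLap hc x x
  simp only [hx, mul_zero, Finset.sum_const_zero] at h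
  have hnn : ∀ i j, 0 ≤ c i j * ((x i - x j) * (x i - x j)) := fun i j =>
    mul_nonneg (h0 i j) (mul_self_nonneg _)
  have h1 := (Finset.sum_eq_zero_iff_of_nonneg
    fun i _ => Finset.sum_nonneg fun j _ => hnn i j).1 h.symm i (Finset.mem_univ i)
  have h2 := (Finset.sum_eq_zero_iff_of_nonneg fun j _ => hnn i j).1 h1 j (Finset.mem_univ j)
  have h3 := (mul_eq_zero.1 h2).resolve_left hij.ne'
  linarith [mul_self_eq_zero.1 h3]

/-- The Laplacian as an operator on Euclidean space. -/
noncomputable def weightedLapHom (c : V → V → ℝ) :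
    EuclideanSpace ℝ V →ₗ[ℝ] EuclideanSpace ℝ V where
  toFun x := WithLp.toLp 2 fun i => weightedLap c x i
  map_add' x y := by
    ext i
    simp only [weightedLap, PiLp.add_apply, ← Finset.sum_add_distrib]
    exact Finset.sum_congr rfl fun j _ => by ring
  map_smul' r x := by
    ext i
    simp only [weightedLap, PiLp.smul_apply, smul_eq_mul, Finset.mul_sum, RingHom.id_apply]
    exact Finset.sum_congr rfl fun j _ => by ring

/-- Fredholm alternative: the range of a symmetric operator is the orthogonal complement of its
kernel, and the kernel is constant across positive weights. -/
theorem exists_weightedLap_eq (hc : ∀ i j, c i j = c j i) (h0 : ∀ i j, 0 ≤ c i j) (q : V → ℝ)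
    (hq : ∀ x : V → ℝ, (∀ i j, 0 < c i j → x i = x j) → ∑ i, x i * q i = 0) :
    ∃ θ : V → ℝ, ∀ i, weightedLap c θ i = q i := by
  have hsym : (weightedLapHom c).IsSymmetric := fun x y => by
    have h := sum_mul_weightedLap_comm hc x y
    simp only [weightedLapHom, LinearMap.coe_mk, AddHom.coe_mk, PiLp.inner_apply,
      RCLike.inner_apply, conj_trivial]
    rw [← h]
    exact Finset.sum_congr rfl fun i _ => mul_comm _ _
  have hmem : WithLp.toLp 2 q ∈ (weightedLapHom c).range := by
    rw [← Submodule.orthogonal_orthogonal (weightedLapHom c).range, hsym.orthogonal_range,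
      Submodule.mem_orthogonal]
    intro x hx
    have hx' : ∀ i, weightedLap c x i = 0 := fun i =>
      congrArg (fun y : EuclideanSpace ℝ V => y i) (LinearMap.mem_ker.1 hx)
    simp only [PiLp.inner_apply, RCLike.inner_apply, conj_trivial]
    rw [← hq x fun i j hij => eq_of_weightedLap_eq_zero hc h0 hx' hij]
    exact Finset.sum_congr rfl fun i _ => mul_comm _ _
  obtain ⟨θ, hθ⟩ := hmem
  exact ⟨θ, fun i => congrArg (fun y : EuclideanSpace ℝ V => y i) hθ⟩

/-- A potential that is superharmonic off `t` descends to `t` along a simple path from every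
vertex that has a higher neighbour. -/
theorem exists_isPath_descending (H : SimpleGraph V) (hH : ∀ i j, 0 < c i j → H.Adj i j)
    (hc : ∀ i j, c i j = c j i) (h0 : ∀ i j, 0 ≤ c i j) (x : V → ℝ) (t : V) (hx : ∀ i, i ≠ t → 0 ≤ weightedLap c x i) (v : V) :
    ∀ w, 0 < c v w → x v < x w →
      ∃ P : H.Walk v t, P.IsPath ∧ ∀ k ∈ P.support, x k ≤ x v := by
  have wf : WellFounded fun a b : V => x a < x b :=
    @Finite.wellFounded_of_trans_of_irrefl V _ (fun a b : V => x a < x b)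
      ⟨fun _ _ _ h h' => lt_trans h h'⟩ ⟨fun _ => lt_irrefl _⟩
  induction v using wf.induction with
  | _ v ih =>
    intro w hw hvw
    by_cases hvt : v = t
    · subst hvt
      exact ⟨.nil, by simp, by simp⟩
    -- Superharmonicity at `v` forces the higher neighbour `w` to be offset by a lower one.
    · obtain ⟨z, hz⟩ : ∃ z, 0 < c v z * (x v - x z) := by
        by_contra! hcon
        have hlt : weightedLap c x v < ∑ _j : V, (0 : ℝ) :=
          Finset.sum_lt_sum (fun j _ => hcon j)
            ⟨w, Finset.mem_univ w, mul_neg_of_pos_of_neg hw (by linarith)⟩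
        rw [Finset.sum_const_zero] at hlt
        exact absurd (hx v hvt) (not_le.2 hlt)
      have hcz : 0 < c v z := (h0 v z).lt_of_ne fun h => by simp [← h] at hz
      have hxz : x z < x v := by linarith [(pos_iff_pos_of_mul_pos hz).1 hcz]
      obtain ⟨P, hP, hPx⟩ := ih z hxz v (hc v z ▸ hcz) hxz
      refine ⟨.cons (hH v z hcz) P, (SimpleGraph.Walk.cons_isPath_iff _ _).2
        ⟨hP, fun h => absurd (hPx v h) (not_le.2 hxz)⟩, fun k hk => ?_⟩
      rcases List.mem_cons.1 (by simpa using hk) with rfl | hk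
      · exact le_rfl
      · exact (hPx k hk).trans hxz.le

/-- Descend from `v` to the sink and climb from `u` to the source. The two pieces are disjoint,
being separated by the drop from `x u` to `x v`. -/
theorem exists_isPath_of_potential_lt [DecidableEq V] (H : SimpleGraph V)
    (hH : ∀ i j, 0 < c i j → H.Adj i j)
    (hc : ∀ i j, c i j = c j i) (h0 : ∀ i j, 0 ≤ c i j) (x : V → ℝ) (s t : V)
    (hx : ∀ i, weightedLap c x i = (if i = s then 1 else 0) - (if i = t then 1 else 0))
    {u v : V} (huv : 0 < c u v) (hlt : x v < x u) :
    ∃ P : H.Walk s t, P.IsPath ∧ s(u, v) ∈ P.edges := by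
  obtain ⟨B, hB, hBx⟩ := exists_isPath_descending H hH hc h0 x t
    (fun i hi => by rw [hx, if_neg hi]; split_ifs <;> norm_num) v u (hc u v ▸ huv) hlt
  obtain ⟨A, hA, hAx⟩ := exists_isPath_descending H hH hc h0 (fun k => -x k) s
    (fun i hi => by rw [weightedLap_neg, hx, if_neg hi]; split_ifs <;> norm_num) u v huv
    (neg_lt_neg hlt)
  refine ⟨A.reverse.append (.cons (hH u v huv) B), ?_, by simp⟩
  rw [SimpleGraph.Walk.isPath_def, SimpleGraph.Walk.support_append, SimpleGraph.Walk.support_cons,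
    List.tail_cons, List.nodup_append']
  refine ⟨hA.reverse.support_nodup, hB.support_nodup, fun k hkA hkB => ?_⟩
  rw [SimpleGraph.Walk.support_reverse, List.mem_reverse] at hkA
  linarith [hAx k hkA, hBx k hkB]

/-- The potential of a unit transfer across the line `s(u, v)` takes the same value at the ends of
any transfer whose simple paths all avoid that line. -/
theorem potential_eq_of_forall_isPath [DecidableEq V] (H : SimpleGraph V) (hconn : H.Connected)
    (hH : ∀ i j, 0 < c i j ↔ H.Adj i j)
    (hc : ∀ i j, c i j = c j i) (h0 : ∀ i j, 0 ≤ c i j) {u v : V} (huv : H.Adj u v) {y : V → ℝ}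
    (hy : ∀ i, weightedLap c y i = (if i = u then 1 else 0) - (if i = v then 1 else 0)) {s t : V}
    (hst : ∀ P : H.Walk s t, P.IsPath → s(u, v) ∉ P.edges) : y s = y t := by
  have key : ∀ x : V → ℝ, ∀ a b : V,
      ∑ i, x i * ((if i = a then 1 else 0) - (if i = b then 1 else 0)) = x a - x b := fun x a b => by
    simp [mul_sub, Finset.sum_sub_distrib]
  obtain ⟨x, hx⟩ := exists_weightedLap_eq hc h0
    (fun i => (if i = s then 1 else 0) - (if i = t then 1 else 0)) fun z hz => by
      rw [key, sub_eq_zero]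
      exact eq_of_reachable_of_forall_adj (fun i j h => hz i j ((hH i j).2 h))
        (hconn.preconnected s t)
  -- Reciprocity: this becomes `y s - y t = x u - x v`, up to order.
  have h := sum_mul_weightedLap_comm hc x y
  simp only [hx, hy, key] at h
  have hxuv : x u = x v := by
    rcases lt_trichotomy (x u) (x v) with hlt | heq | hlt
    · obtain ⟨P, hP, hmem⟩ := exists_isPath_of_potential_lt H (fun i j => (hH i j).1) hc h0 x s t hx
        ((hH v u).2 huv.symm) hlt
      exact absurd (Sym2.eq_swap ▸ hmem) (hst P hP)
    · exact heq
    · obtain ⟨P, hP, hmem⟩ := exists_isPath_of_potential_lt H (fun i j => (hH i j).1) hc h0 x s t hx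
        ((hH u v).2 huv) hlt
      exact absurd hmem (hst P hP)
  linarith

end Laplacian

/-- A line on some simple path between the ends of another line is in the block of that line. -/
theorem sameBlock_of_mem_edges {V : Type*} {H : SimpleGraph V} {x y : V} (hxy : H.Adj x y)
    {P : H.Walk x y} (hP : P.IsPath) {e : Sym2 V} (he : e ∈ P.edges) : SameBlock H e s(x, y) := by
  by_cases hmem : s(x, y) ∈ P.edges
  · left
    cases P with
    | nil => simp at he
    | @cons _ w _ h Q =>
      rw [SimpleGraph.Walk.cons_isPath_iff] at hP
      rw [SimpleGraph.Walk.edges_cons, List.mem_cons] at hmem he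
      rcases hmem with hmem | hmem
      -- The rest of the path is a simple path from `y` to itself, hence empty.
      · obtain rfl : y = w := Sym2.congr_right.1 hmem
        have hQ := SimpleGraph.Walk.eq_nil_iff_nil.2 (SimpleGraph.Walk.isPath_iff_nil.1 hP.1)
        simpa [hQ] using he
      · exact absurd (Q.fst_mem_support_of_mem_edges hmem) hP.2
  · refine .inr ⟨y, .cons hxy.symm P, (SimpleGraph.Walk.cons_isCycle_iff _ _).2
      ⟨hP, by rwa [Sym2.eq_swap]⟩, by simp [he], by simp [Sym2.eq_swap]⟩

open Classical in
/-- The susceptance of the line `s(i, j)`, or zero if it is not a line. -/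
noncomputable def lineWeight {V : Type*} (G : SimpleGraph V) (b : Sym2 V → ℝ) (i j : V) : ℝ :=
  if G.Adj i j then b s(i, j) else 0

/-! ### DC flows as Laplacian potentials -/

section Flow

variable {V : Type*} {G : SimpleGraph V} {b : Sym2 V → ℝ}

theorem lineWeight_comm (i j : V) : lineWeight G b i j = lineWeight G b j i := by
  unfold lineWeight
  by_cases h : G.Adj i j
  · rw [if_pos h, if_pos h.symm, Sym2.eq_swap]
  · rw [if_neg h, if_neg fun h' => h h'.symm]

theorem lineWeight_nonneg (hb : ∀ e ∈ G.edgeSet, 0 < b e) (i j : V) : 0 ≤ lineWeight G b i j := by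
  unfold lineWeight
  split_ifs with h
  · exact (hb _ h).le
  · exact le_rfl

theorem lineWeight_pos_iff (hb : ∀ e ∈ G.edgeSet, 0 < b e) (i j : V) :
    0 < lineWeight G b i j ↔ G.Adj i j := by
  unfold lineWeight
  split_ifs with h
  · exact ⟨fun _ => h, fun _ => hb _ h⟩
  · simp [h]

variable [Fintype V]

theorem isDCFlow_iff {p : V → ℝ} {f : V → V → ℝ} :
    IsDCFlow G b p f ↔ ∃ θ : V → ℝ, (∀ i j, f i j = lineWeight G b i j * (θ i - θ j)) ∧
      ∀ i, weightedLap (lineWeight G b) θ i = p i := by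
  constructor
  · rintro ⟨⟨θ, hθ⟩, h0, hp⟩
    have hf : ∀ i j, f i j = lineWeight G b i j * (θ i - θ j) := fun i j => by
      unfold lineWeight
      split_ifs with h
      · exact hθ i j h
      · rw [h0 i j h, zero_mul]
    exact ⟨θ, hf, fun i => by rw [hp i]; exact Finset.sum_congr rfl fun j _ => (hf i j).symm⟩
  · rintro ⟨θ, hf, hp⟩
    refine ⟨⟨θ, fun i j h => by rw [hf, lineWeight, if_pos h]⟩,
      fun i j h => by rw [hf, lineWeight, if_neg h, zero_mul], fun i => ?_⟩
    rw [← hp i]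
    exact Finset.sum_congr rfl fun j _ => (hf i j).symm

theorem sumOver_eq_sum_subtype (S : Set V) [Fintype S] (p : V → ℝ) :
    sumOver S p = ∑ i : S, p i :=
  Finset.sum_subtype _ (by simp) _

theorem existsUnique_isDCFlow (hb : ∀ e ∈ G.edgeSet, 0 < b e) {p : V → ℝ}
    (hp : BalancedInjections G p) : ∃! f : V → V → ℝ, IsDCFlow G b p f := by
  classical
  obtain ⟨θ, hθ⟩ := exists_weightedLap_eq (lineWeight_comm (G := G) (b := b))
    (lineWeight_nonneg hb) p fun x hx => by
      have hx' : ∀ i j, G.Adj i j → x i = x j := fun i j h => hx i j ((lineWeight_pos_iff hb i j).2 h)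
      -- A kernel vector is constant on each island, where `p` sums to zero.
      rw [← Finset.sum_fiberwise (s := Finset.univ) (g := G.connectedComponentMk)]
      refine Finset.sum_eq_zero fun C _ => ?_
      induction C using SimpleGraph.ConnectedComponent.ind with
      | _ a =>
        have h := hp (G.connectedComponentMk a)
        simp only [sumOver, SimpleGraph.ConnectedComponent.mem_supp_iff] at h
        calc _ = ∑ i with G.connectedComponentMk i = G.connectedComponentMk a, x a * p i :=
              Finset.sum_congr rfl fun i hi => by
                rw [eq_of_reachable_of_forall_adj hx'
                  (SimpleGraph.ConnectedComponent.exact (Finset.mem_filter.1 hi).2)]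
          _ = 0 := by rw [← Finset.mul_sum]; convert mul_zero (x a)
  refine ⟨_, isDCFlow_iff.2 ⟨θ, fun _ _ => rfl, hθ⟩, fun f hf => ?_⟩
  obtain ⟨η, hη, hηp⟩ := isDCFlow_iff.1 hf
  have hz : ∀ i, weightedLap (lineWeight G b) (fun k => η k - θ k) i = 0 := fun i => by
    rw [← sub_eq_zero.2 ((hηp i).trans (hθ i).symm)]
    simp only [weightedLap, ← Finset.sum_sub_distrib]
    exact Finset.sum_congr rfl fun j _ => by ring
  ext i j
  rw [hη]
  rcases (lineWeight_nonneg hb i j).eq_or_lt with h | h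
  · simp [← h]
  · have := eq_of_weightedLap_eq_zero lineWeight_comm (lineWeight_nonneg hb) hz h
    congr 1
    linarith

end Flow

/-! ### Transfers that do no work, and the main theorem -/

theorem sum_sum_eq_zero_of_antisymm {J : Type*} [Fintype J] {d : J → J → ℝ}
    (hd : ∀ i j, d j i = -d i j) : ∑ i, ∑ j, d i j = 0 := by
  have h : ∑ i, ∑ j, d i j = -∑ i, ∑ j, d i j := by
    conv_lhs => rw [Finset.sum_comm]
    rw [← Finset.sum_neg_distrib]
    exact Finset.sum_congr rfl fun i _ => by
      rw [← Finset.sum_neg_distrib]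
      exact Finset.sum_congr rfl fun j _ => hd i j
  linarith

/-- An antisymmetric array of transfers between points of equal potential does no work. -/
theorem sum_mul_sum_eq_zero_of_antisymm {J : Type*} [Fintype J] {d : J → J → ℝ} {y : J → ℝ}
    (hd : ∀ i j, d j i = -d i j) (hy : ∀ i j, d i j ≠ 0 → y i = y j) :
    ∑ i, y i * ∑ j, d i j = 0 := by
  simp only [Finset.mul_sum]
  refine sum_sum_eq_zero_of_antisymm fun i j => ?_
  rcases eq_or_ne (d i j) 0 with h | h
  · rw [hd, h, neg_zero, mul_zero, mul_zero, neg_zero]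
  · rw [hd, hy i j h]; ring

/-- As `α` has total 1, the source `t - α ∑ t` splits into transfers of size `t j * α k` between `j`
and `k`. -/
theorem sum_mul_sub_eq_zero {J : Type*} [Fintype J] {t α y : J → ℝ} (hα : ∑ k, α k = 1)
    (hy : ∀ j k, t j ≠ 0 → α k ≠ 0 → y j = y k) :
    ∑ i, y i * (t i - α i * ∑ j, t j) = 0 := by
  have h : ∑ j, ∑ k, t j * α k * (y j - y k) = 0 :=
    Finset.sum_eq_zero fun j _ => Finset.sum_eq_zero fun k _ => by
      by_cases hj : t j = 0
      · simp [hj]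
      · by_cases hk : α k = 0
        · simp [hk]
        · simp [hy j k hj hk]
  rw [← h]
  have h1 : ∑ j, ∑ k, t j * α k * y j = ∑ j, y j * t j :=
    Finset.sum_congr rfl fun j _ => by
      rw [← Finset.sum_mul, ← Finset.mul_sum, hα]; ring
  have h2 : ∑ j, ∑ k, t j * α k * y k = ∑ k, y k * (α k * ∑ j, t j) := by
    rw [Finset.sum_comm]
    exact Finset.sum_congr rfl fun k _ => by
      simp only [Finset.mul_sum]
      exact Finset.sum_congr rfl fun j _ => by ring
  simp only [mul_sub, Finset.sum_sub_distrib, h1, h2]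

/-- Here `I` is an island of the surviving network `G.deleteEdges F`, the injections `p'` after
the outage are `p` adjusted by the proportional control on `I` and arbitrary but balanced on the
other islands, and `s(u, v)` is a surviving line of `I`.  Blocks and simple paths are those of
`G.induce I.supp`, the subnetwork on `I` before the outage. -/
theorem mainTheorem8 {V : Type*} [Fintype V] (G : SimpleGraph V) (hG : G.Connected)
    (b : Sym2 V → ℝ) (hb : ∀ e ∈ G.edgeSet, 0 < b e)
    (p : V → ℝ) (hp : BalancedInjections G p)
    (F : Set (Sym2 V)) (hF : IsCutSet G F)
    (I : (G.deleteEdges F).ConnectedComponent)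
    (α : V → ℝ) (hα : IsProportionalControl I.supp α)
    (p' : V → ℝ) (hp' : BalancedInjections (G.deleteEdges F) p') (hI : AdjustedBy I.supp α p p')
    (u v : I.supp) (huv : (G.deleteEdges F).Adj (u : V) (v : V))
    (hint : ∀ x y : I.supp, s((x : V), (y : V)) ∈ F →
      ¬ SameBlock (G.induce I.supp) s(u, v) s(x, y))
    (htie : ∀ (i : V) (j : I.supp), i ∉ I.supp → s(i, (j : V)) ∈ F →
      ∀ k : I.supp, 0 < α (k : V) →
        ∀ P : (G.induce I.supp).Walk j k, P.IsPath → s(u, v) ∉ P.edges) :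
    (∃! f : V → V → ℝ, IsDCFlow G b p f) ∧
    (∃! f' : V → V → ℝ, IsDCFlow (G.deleteEdges F) b p' f') ∧
    ∀ f f' : V → V → ℝ, IsDCFlow G b p f → IsDCFlow (G.deleteEdges F) b p' f' →
      f' (u : V) (v : V) = f (u : V) (v : V) := by
  classical
  have hb' : ∀ e ∈ (G.deleteEdges F).edgeSet, 0 < b e := fun e he =>
    hb e (SimpleGraph.edgeSet_mono (SimpleGraph.deleteEdges_le F) he)
  refine ⟨existsUnique_isDCFlow hb hp, existsUnique_isDCFlow hb' hp', fun f f' hf hf' => ?_⟩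
  obtain ⟨θ, hfθ, hθ⟩ := isDCFlow_iff.1 hf
  obtain ⟨η, hfη, hη⟩ := isDCFlow_iff.1 hf'
  set H := G.induce I.supp
  -- The island is already connected by its surviving lines.
  have hHconn : H.Connected :=
    I.connected_toSimpleGraph.mono fun i j h => SimpleGraph.deleteEdges_le F h
  let c : I.supp → I.supp → ℝ := fun i j => lineWeight G b i j
  have hc : ∀ i j, c i j = c j i := fun i j => lineWeight_comm _ _
  have hc0 : ∀ i j, 0 ≤ c i j := fun i j => lineWeight_nonneg hb _ _
  have hcH : ∀ i j, 0 < c i j ↔ H.Adj i j := fun i j => lineWeight_pos_iff hb _ _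
  have hGuv : G.Adj u v := SimpleGraph.deleteEdges_le F huv
  have key : ∀ x : I.supp → ℝ, ∀ s t : I.supp,
      ∑ i, x i * ((if i = s then 1 else 0) - (if i = t then 1 else 0)) = x s - x t :=
    fun x s t => by simp [mul_sub, Finset.sum_sub_distrib]
  obtain ⟨y, hy⟩ := exists_weightedLap_eq hc hc0
    (fun i => (if i = u then 1 else 0) - (if i = v then 1 else 0)) fun z hz => by
      rw [key, hz u v ((hcH u v).2 hGuv), sub_self]
  -- the tie-line flow into each bus, and the fictitious outflow on the internal outaged lines
  let t : I.supp → ℝ := fun i => ∑ j with j ∉ I.supp, f i j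
  let d : I.supp → I.supp → ℝ := fun i j => c i j * (η i - η j) - f' i j
  have hd : ∀ i j, d j i = -d i j := fun i j => by
    simp only [d, hfη, hc j i, lineWeight_comm (j : V) (i : V)]; ring
  have hp_eq : ∀ i : I.supp, p i = ∑ j : I.supp, f i j + t i := fun i => by
    rw [hf.2.2 i, ← Finset.sum_filter_add_sum_filter_not Finset.univ (· ∈ I.supp)]
    congr 1
    exact Finset.sum_subtype _ (by simp) _
  have hp'_eq : ∀ i : I.supp, p' i = ∑ j : I.supp, f' i j := fun i => by
    rw [hf'.2.2 i, ← Finset.sum_filter_add_sum_filter_not Finset.univ (· ∈ I.supp)]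
    rw [Finset.sum_eq_zero (s := Finset.univ.filter (· ∉ I.supp)), add_zero]
    · exact Finset.sum_subtype _ (by simp) _
    · intro j hj
      refine hf'.2.1 i j fun hadj => (Finset.mem_filter.1 hj).2 ?_
      exact I.mem_supp_of_adj_mem_supp i.2 hadj
  have hS : sumOver I.supp p = ∑ i, t i := by
    rw [sumOver_eq_sum_subtype]
    simp only [hp_eq, Finset.sum_add_distrib]
    rw [sum_sum_eq_zero_of_antisymm, zero_add]
    intro i j
    rw [hfθ, hfθ, lineWeight_comm]; ring
  have hlap : ∀ i, weightedLap c (fun k : I.supp => η k - θ k) i =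
      (t i - α i * ∑ j, t j) + ∑ j, d i j := fun i => by
    have h1 := hI i i.2
    rw [hS, hp_eq, hp'_eq] at h1
    have h2 : weightedLap c (fun k : I.supp => η k - θ k) i =
        ∑ j, d i j + ∑ j : I.supp, f' i j - ∑ j : I.supp, f i j := by
      simp only [weightedLap, ← Finset.sum_add_distrib, ← Finset.sum_sub_distrib]
      refine Finset.sum_congr rfl fun j _ => ?_
      simp only [d, hfθ, c]; ring
    rw [h2]; linarith
  -- `d` lives on outaged internal lines; a simple path between the ends of one through `s(u, v)`
  -- would put both in one block.
  have hyd : ∀ i j, d i j ≠ 0 → y i = y j := fun i j hij => by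
    have hadj : H.Adj i j := by
      by_contra hn
      have hn' : ¬ G.Adj i j := hn
      refine hij ?_
      simp [d, c, lineWeight, hn', hfη]
    have hmem : s((i : V), (j : V)) ∈ F := by
      by_contra hn
      have hadj' : G.Adj i j := hadj
      refine hij ?_
      simp [d, c, lineWeight, hadj', hn, hfη]
    exact potential_eq_of_forall_isPath H hHconn hcH hc hc0 hGuv hy fun P hP he =>
      hint i j hmem (sameBlock_of_mem_edges hadj hP he)
  have hyt : ∀ j k : I.supp, t j ≠ 0 → α k ≠ 0 → y j = y k := fun j k hj hk => by
    obtain ⟨i, hi, hji⟩ := Finset.exists_ne_zero_of_sum_ne_zero hj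
    have hi' := (Finset.mem_filter.1 hi).2
    have hadj : G.Adj j i := by
      by_contra hn
      exact hji (hf.2.1 _ _ hn)
    have hmem : s(i, (j : V)) ∈ F := by
      by_contra hn
      refine hi' (I.mem_supp_of_adj_mem_supp j.2 (SimpleGraph.deleteEdges_adj.2 ⟨hadj, ?_⟩))
      rwa [Sym2.eq_swap]
    exact potential_eq_of_forall_isPath H hHconn hcH hc hc0 hGuv hy
      (htie i j hi' hmem k ((hα.1 k k.2).lt_of_ne' hk))
  have hα1 : ∑ k : I.supp, α k = 1 := by rw [← sumOver_eq_sum_subtype]; exact hα.2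
  -- Pairing with `y` turns the drop of `η - θ` across `s(u, v)` into the work of the transfers,
  -- which is zero.
  have hφ := sum_mul_weightedLap_comm hc (fun k : I.supp => η k - θ k) y
  simp only [hy, key, hlap] at hφ
  simp only [mul_add, Finset.sum_add_distrib] at hφ
  rw [sum_mul_sub_eq_zero hα1 hyt, sum_mul_sum_eq_zero_of_antisymm hd hyd] at hφ
  rw [hfη, hfθ, lineWeight, lineWeight, if_pos huv, if_pos hGuv]
  congr 1
  linarith
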